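/- Let $d\ge 2$, let $\Omega_{\rm box}\subset\mathbb{R}^d$ be an open hyper-rectangle, and let $U$ be a bounded domain of class $C^2$ with $\overline U\subset\Omega_{\rm box}$ that is diffeomorphic to the open unit ball of $\mathbb{R}^d$. For $\delta>0$ write $\mathrm{Neigh}_\delta(\partial U)=\{x\in\Omega_{\rm box}:\mathrm{dist}(x,\partial U)<\delta\}$. We say that $U$ is $\delta$-regular if, for every $x\in\partial U$, every set $V$ with $\overline V\subset\Omega_{\rm box}$ that is diffeomorphic to the open unit ball and satisfies $\partial V\subset\mathrm{Neigh}_\delta(\partial U)\setminus\mathcal{B}_\delta(x)$ is contained in $\mathrm{Neigh}_\delta(\partial U)$. Here $\mathcal{B}_\rho(x)$ is the open ball of radius $\rho$ centered at $x$, and diffeomorphisms are of class $C^1$ in both directions. (i) There exists $\delta_0>0$ such that $U$ is $\delta$-regular for every $0<\delta<\delta_0$. (ii) Let $r,L,L_{\rm inv},\kappa_{\max}>0$ be such that the absolute values of the principal curvatures of $\partial U$ are bounded by $\kappa_{\max}$ on all of $\partial U$ and such that, for every $x\in\partial U$, there is a map $\Phi_x$ with the following properties: $\Phi_x$ is a bijection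 of the half-ball $A=\mathcal{B}_r(0)\cap\{x':x'_d<0\}$ onto $U\cap\mathcal{B}_r(x)$; $\Phi_x$ is Lipschitz with constant $L$ and its inverse is Lipschitz with constant $L_{\rm inv}$, both up to the flat face $\{[s,0]: s\in\mathbb{R}^{d-1},\ \|s\|_2<r\}$ of $A$; and $s\mapsto\Phi_x([s,0])$, $\|s\|_2<r$, is a regular ($C^1$, injective, with injective differential) parameterization of $\partial U\cap\mathcal{B}_r(x)$. Then $U$ is $\delta$-regular for every $$0<\delta<\min\Big\{\frac r2,\ \frac{1}{L\,L_{\rm inv}\,\kappa_{\max}}\Big\}.$$ -/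

import Mathlib

/-- The Euclidean space `ℝ^d`. -/
abbrev Euc (d : ℕ) : Type := EuclideanSpace ℝ (Fin d)

/-- The open hyper-rectangle with opposite corners `a` and `b`. -/
def openBox {d : ℕ} (a b : Euc d) : Set (Euc d) :=
  {x | ∀ i, a i < x i ∧ x i < b i}

/-- `V` is diffeomorphic to the open unit ball of `ℝ^d`: there is a bijection of the open unit ball
onto `V` which is `C¹` and has a `C¹` inverse (`V` is then open). -/
def DiffeoUnitBall {d : ℕ} (V : Set (Euc d)) : Prop :=
  ∃ e : OpenPartialHomeomorph (Euc d) (Euc d),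
    e.source = Metric.ball 0 1 ∧ e.target = V ∧
      ContDiffOn ℝ 1 e e.source ∧ ContDiffOn ℝ 1 e.symm e.target

/-- `ρ` is a `C²` defining function of `U` near the boundary point `x`:
near `x` the set `U` is `{ρ < 0}`, and the gradient of `ρ` does not vanish at `x`. -/
structure IsC2DefiningAt {d : ℕ} (U : Set (Euc d)) (x : Euc d) (ρ : Euc d → ℝ) : Prop where
  contDiffAt : ContDiffAt ℝ 2 ρ x
  eq_zero : ρ x = 0
  gradient_ne_zero : gradient ρ x ≠ 0
  mem_iff : ∀ᶠ y in nhds x, (y ∈ U ↔ ρ y < 0)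

/-- Bounded domains of class `C²`. -/
structure IsC2Domain {d : ℕ} (U : Set (Euc d)) : Prop where
  isOpen : IsOpen U
  isConnected : IsConnected U
  isBounded : Bornology.IsBounded U
  exists_defining : ∀ x ∈ frontier U, ∃ ρ : Euc d → ℝ, IsC2DefiningAt U x ρ

/-- The normalized gradient of `ρ`. If `ρ` is a defining function of `U` near `x ∈ ∂U`, then near
`x` it is an extension of the outward unit normal `n` of `∂U` to a neighbourhood of `x`. -/
noncomputable def unitGradient {d : ℕ} (ρ : Euc d → ℝ) (y : Euc d) : Euc d :=
  ‖gradient ρ y‖⁻¹ • gradient ρ y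

/-- `κ` is a principal curvature of `∂U` at `x`: an eigenvalue of the shape operator
`S[x] t = - lim_{ε → 0} (n (x + ε t) - n x) / ε` on the tangent space `T_x = (n x)^⊥`.
The tangential derivatives of `n` at `x` depend on the values of `n` on `∂U` only, so that
the choice of the defining function does not matter. -/
def IsPrincipalCurvature {d : ℕ} (U : Set (Euc d)) (x : Euc d) (κ : ℝ) : Prop :=
  ∃ ρ : Euc d → ℝ, IsC2DefiningAt U x ρ ∧
    ∃ t : Euc d, t ≠ 0 ∧ inner ℝ t (unitGradient ρ x) = 0 ∧
      -(fderiv ℝ (unitGradient ρ) x t) = κ • t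

/-- The point `[s, 0]` of `ℝ^{n+1}`, for `s ∈ ℝ^n`. -/
noncomputable def flatEmb {n : ℕ} (s : Euc n) : Euc (n + 1) :=
  WithLp.toLp 2 (Fin.snoc (α := fun _ => ℝ) (fun i => s i) 0)

/-- The open half-ball `B_r(0) ∩ {x' : (x')_d < 0}` of `ℝ^d`, `d = n + 1`. -/
def halfBall (n : ℕ) (r : ℝ) : Set (Euc (n + 1)) :=
  {p | p ∈ Metric.ball 0 r ∧ p (Fin.last n) < 0}

/-- The half-ball together with its flat face `{[s, 0] : s ∈ C_r(0)}`. -/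
def halfBallWithFace (n : ℕ) (r : ℝ) : Set (Euc (n + 1)) :=
  {p | p ∈ Metric.ball 0 r ∧ p (Fin.last n) ≤ 0}

/-- `Φ` is a bi-Lipschitz chart of `U` on the ball `B_r(x)`: a bijection of the open half-ball of
radius `r` onto `U ∩ B_r(x)`, with Lipschitz constant `L` and inverse of Lipschitz constant `Linv`
(both up to the flat face, to which `Φ` extends by continuity), and such that `s ↦ Φ [s, 0]` is a
regular parameterization of `∂U ∩ B_r(x)` by the `n`-dimensional ball `C_r(0)`. -/
structure IsBoundaryChart {n : ℕ} (U : Set (Euc (n + 1))) (x : Euc (n + 1)) (r L Linv : ℝ)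
    (Φ : Euc (n + 1) → Euc (n + 1)) : Prop where
  bijOn : Set.BijOn Φ (halfBall n r) (U ∩ Metric.ball x r)
  lipschitz : ∀ p ∈ halfBallWithFace n r, ∀ q ∈ halfBallWithFace n r,
    dist (Φ p) (Φ q) ≤ L * dist p q
  lipschitz_inv : ∀ p ∈ halfBallWithFace n r, ∀ q ∈ halfBallWithFace n r,
    dist p q ≤ Linv * dist (Φ p) (Φ q)
  face_bijOn : Set.BijOn (fun s : Euc n => Φ (flatEmb s)) (Metric.ball 0 r)
    (frontier U ∩ Metric.ball x r)
  face_contDiffOn : ContDiffOn ℝ 1 (fun s : Euc n => Φ (flatEmb s)) (Metric.ball 0 r)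
  face_regular : ∀ s ∈ Metric.ball (0 : Euc n) r,
    Function.Injective (fderiv ℝ (fun s : Euc n => Φ (flatEmb s)) s)

/-- `Neigh_δ(S)`, the `δ`-neighbourhood of `S` in the box `Ω`. -/
def neigh {d : ℕ} (Ω : Set (Euc d)) (δ : ℝ) (S : Set (Euc d)) : Set (Euc d) :=
  {x | x ∈ Ω ∧ Metric.infDist x S < δ}

/-- `U` is `δ`-regular (in the box `Ω`): for every `x ∈ ∂U`, every set `V`, compactly embedded in
`Ω` and diffeomorphic to the unit ball, with `∂V ⊆ Neigh_δ(∂U) \ B_δ(x)` is contained in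
`Neigh_δ(∂U)`. -/
def DeltaRegular {d : ℕ} (Ω : Set (Euc d)) (δ : ℝ) (U : Set (Euc d)) : Prop :=
  ∀ x ∈ frontier U, ∀ V : Set (Euc d), DiffeoUnitBall V → closure V ⊆ Ω →
    frontier V ⊆ neigh Ω δ (frontier U) \ Metric.ball x δ →
      V ⊆ neigh Ω δ (frontier U)

/-! Both parts reduce to one statement: if the outward unit normal `ν` of `∂U` is `M`-Lipschitz at
distances below `r`, then `U` is `δ`-regular whenever `δ < r/2` and `δ M < 1`. Under these bounds
every point within `δ` of `∂U` has a unique nearest boundary point (`nearest_unique`), and the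
points `p ± s ν p` with `s ≤ δ` lie at distance exactly `s` from `∂U` (`infDist_add_smul`). Pushing
the collar along the normals then shows that the inner core and the outer core, the points at
distance at least `δ` inside and outside `U`, are connected. For the outer core, the complement of a
slightly shrunken copy of the ball `U` is pushed outwards; it is connected because a point does not
separate a space of dimension at least two. Since `∂V` avoids both cores, `V` contains or misses
each of them. The outer core is unbounded, so `V` misses it. If `V` contained the inner core, it
would contain `x - δ ν x`, hence all of `B_δ(x)`, which `∂V` avoids, and hence `x + δ ν x`, a point
of the outer core (`infDist_lt_of_frontier`). For (i), compactness supplies `r` and `M`. For (ii),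
integrating the derivative of the normal along the image of a segment in a chart gives `M = L * Linv
* κmax`. -/

open Metric Set Filter Topology

/-! ### Topological preliminaries -/

/-- A connected set which avoids the frontier of an open set and meets the open set lies in it. -/
theorem IsPreconnected.subset_of_disjoint_frontier {X : Type*} [TopologicalSpace X] {K V : Set X}
    (hK : IsPreconnected K) (hV : IsOpen V) (hKV : (K ∩ V).Nonempty)
    (hfr : ∀ y ∈ K, y ∉ frontier V) : K ⊆ V := by
  refine hK.subset_of_closure_inter_subset hV hKV ?_
  rintro y ⟨hy, hyK⟩
  by_contra hyV
  exact hfr y hyK ⟨hy, by rwa [hV.interior_eq]⟩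

/-- Gluing continuity along two closed sets which cover the domain. -/
theorem ContinuousOn.of_closed_cover {X Y : Type*} [TopologicalSpace X] [TopologicalSpace Y]
    {f : X → Y} {D s t : Set X} (hs : IsClosed s) (ht : IsClosed t) (hD : D ⊆ s ∪ t)
    (hfs : ContinuousOn f (D ∩ s)) (hft : ContinuousOn f (D ∩ t)) : ContinuousOn f D := by
  have key : ∀ u : Set X, IsClosed u → ContinuousOn f (D ∩ u) →
      ∀ y ∈ D, ContinuousWithinAt f (D ∩ u) y := by
    intro u hu hfu y hy
    by_cases hyu : y ∈ u
    · exact hfu y ⟨hy, hyu⟩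
    · apply continuousWithinAt_of_notMem_closure
      intro h
      exact hyu (hu.closure_subset (closure_mono inter_subset_right h))
  intro y hy
  have h : D = (D ∩ s) ∪ (D ∩ t) := by
    rw [← inter_union_distrib_left, inter_eq_left.2 hD]
  rw [h, continuousWithinAt_union]
  exact ⟨key s hs hfs y hy, key t ht hft y hy⟩

/-- Nearest points depend continuously on the point, wherever they are unique. -/
theorem IsCompact.eventually_nearest_mem {X : Type*} [PseudoMetricSpace X] {S N : Set X}
    (hS : IsCompact S) {y₀ : X} (hN : IsOpen N)
    (hu : ∀ q ∈ S, dist y₀ q = infDist y₀ S → q ∈ N) :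
    ∀ᶠ y in 𝓝 y₀, ∀ q ∈ S, dist y q = infDist y S → q ∈ N := by
  rcases (S \ N).eq_empty_or_nonempty with h | h
  · exact Eventually.of_forall fun y q hq _ => sdiff_eq_empty.1 h hq
  · have hc : IsCompact (S \ N) := hS.diff hN
    -- The distance to `S \ N` is attained, so it strictly exceeds the distance to `S`; by
    -- continuity the gap persists near `y₀`.
    have hlt : infDist y₀ S < infDist y₀ (S \ N) := by
      obtain ⟨q, hq, hqd⟩ := hc.exists_infDist_eq_dist h y₀
      refine lt_of_le_of_ne (infDist_le_infDist_of_subset sdiff_subset h) fun he => ?_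
      exact hq.2 (hu q hq.1 (by rw [he, hqd]))
    have hev := (continuous_infDist_pt S).continuousAt.eventually_lt
      (continuous_infDist_pt (S \ N)).continuousAt hlt
    filter_upwards [hev] with y hy q hq hqd
    by_contra hqN
    have := infDist_le_dist_of_mem (x := y) (show q ∈ S \ N from ⟨hq, hqN⟩)
    linarith

/-- A compact subset of an embedded open ball lies in a smaller concentric ball. -/
theorem OpenPartialHomeomorph.exists_subset_image_ball {E : Type*}
    [NormedAddCommGroup E] (e : OpenPartialHomeomorph E E)
    (he : e.source = ball 0 1) {K : Set E} (hK : IsCompact K) (hKe : K ⊆ e.target) :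
    ∃ ρ, 0 < ρ ∧ ρ < 1 ∧ K ⊆ e '' ball 0 ρ := by
  rcases K.eq_empty_or_nonempty with rfl | hne
  · exact ⟨1 / 2, by norm_num, by norm_num, empty_subset _⟩
  obtain ⟨y, hy, hmax⟩ := hK.exists_isMaxOn hne (e.continuousOn_symm.mono hKe).norm
  have hy1 : ‖e.symm y‖ < 1 := by
    have := e.map_target (hKe hy)
    rwa [he, mem_ball_zero_iff] at this
  refine ⟨(‖e.symm y‖ + 1) / 2, by positivity, by linarith, fun z hz => ?_⟩
  refine ⟨e.symm z, ?_, e.right_inv (hKe hz)⟩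
  have : ‖e.symm z‖ ≤ ‖e.symm y‖ := hmax hz
  rw [mem_ball_zero_iff]
  linarith

/-! ### Connectedness of the complement of an embedded ball -/

section Retraction

variable {E : Type*} [NormedAddCommGroup E] [NormedSpace ℝ E] [FiniteDimensional ℝ E]

/-- The complement of an embedded ball is connected: the complement of its centre retracts
onto it. -/
theorem OpenPartialHomeomorph.isPreconnected_compl_image_ball (hdim : 1 < Module.rank ℝ E)
    (e : OpenPartialHomeomorph E E) (he : e.source = ball 0 1) {ρ : ℝ} (h0 : 0 < ρ) (h1 : ρ < 1) :
    IsPreconnected (e '' ball 0 ρ)ᶜ := by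
  classical
  have hcb : closedBall (0 : E) ρ ⊆ e.source := he ▸ closedBall_subset_ball h1
  have hbs : ball (0 : E) ρ ⊆ e.source := ball_subset_closedBall.trans hcb
  have h0s : (0 : E) ∈ e.source := hbs (mem_ball_self h0)
  have hop : IsOpen (e '' ball 0 ρ) := e.isOpen_image_of_subset_source isOpen_ball hbs
  have hcl : IsClosed (e '' closedBall 0 ρ) :=
    ((isCompact_closedBall 0 ρ).image_of_continuousOn (e.continuousOn.mono hcb)).isClosed
  -- Radial projection onto the sphere of radius `ρ`, in the coordinates of `e`. It fixes the image
  -- of that sphere, so it glues with the identity outside to a retraction `f`.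
  let g : E → E := fun y => e ((ρ * ‖e.symm y‖⁻¹) • e.symm y)
  let f : E → E := fun y => if y ∈ (e '' ball 0 ρ)ᶜ then y else g y
  have hsymm0 : ∀ y ∈ ({e 0}ᶜ : Set E) ∩ e '' closedBall 0 ρ, e.symm y ≠ 0 := by
    rintro y ⟨hy0, p, hp, rfl⟩ h
    rw [e.left_inv (hcb hp)] at h
    exact hy0 (by rw [h]; rfl)
  have hnorm : ∀ y ∈ ({e 0}ᶜ : Set E) ∩ e '' closedBall 0 ρ,
      ‖(ρ * ‖e.symm y‖⁻¹) • e.symm y‖ = ρ := by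
    intro y hy
    have := norm_ne_zero_iff.2 (hsymm0 y hy)
    rw [norm_smul, norm_mul, norm_inv, norm_norm, Real.norm_of_nonneg h0.le]
    field_simp
  have hgout : ∀ y ∈ ({e 0}ᶜ : Set E) ∩ e '' closedBall 0 ρ, g y ∈ (e '' ball 0 ρ)ᶜ := by
    rintro y hy ⟨p, hp, hpe⟩
    have h2 := e.injOn (hbs hp) (hcb (by simp [hnorm y hy])) hpe
    have h3 := hnorm y hy
    rw [← h2] at h3
    rw [mem_ball_zero_iff] at hp
    linarith
  have hgcont : ContinuousOn g (({e 0}ᶜ : Set E) ∩ e '' closedBall 0 ρ) := by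
    have hsub : ({e 0}ᶜ : Set E) ∩ e '' closedBall 0 ρ ⊆ e.target := by
      rintro y ⟨-, p, hp, rfl⟩
      exact e.map_source (hcb hp)
    have hs : ContinuousOn e.symm (({e 0}ᶜ : Set E) ∩ e '' closedBall 0 ρ) :=
      e.continuousOn_symm.mono hsub
    refine e.continuousOn.comp ((continuousOn_const.mul (hs.norm.inv₀ fun y hy =>
      norm_ne_zero_iff.2 (hsymm0 y hy))).smul hs) ?_
    intro y hy
    exact hcb (by simp [hnorm y hy])
  have hfg : ∀ y ∈ ({e 0}ᶜ : Set E) ∩ e '' closedBall 0 ρ, f y = g y := by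
    intro y hy
    by_cases hyb : y ∈ (e '' ball 0 ρ)ᶜ
    · obtain ⟨hy0, p, hp, rfl⟩ := hy
      have hpn : ‖p‖ = ρ := by
        refine le_antisymm (by simpa using hp) ?_
        by_contra! h
        exact hyb ⟨p, by simpa using h, rfl⟩
      simp only [f, if_pos hyb, g, e.left_inv (hcb hp), hpn]
      rw [mul_inv_cancel₀ h0.ne', one_smul]
    · simp only [f, if_neg hyb]
  have hcont : ContinuousOn f {e 0}ᶜ := by
    refine ContinuousOn.of_closed_cover hop.isClosed_compl hcl ?_ ?_ (hgcont.congr hfg)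
    · intro y _
      by_cases hyb : y ∈ (e '' ball 0 ρ)ᶜ
      · exact Or.inl hyb
      · exact Or.inr (image_mono ball_subset_closedBall (not_not.1 hyb))
    · exact continuousOn_id.congr fun y hy => if_pos hy.2
  have himg : f '' {e 0}ᶜ = (e '' ball 0 ρ)ᶜ := by
    apply Subset.antisymm
    · rintro _ ⟨y, hy, rfl⟩
      by_cases hyb : y ∈ (e '' ball 0 ρ)ᶜ
      · simpa only [f, if_pos hyb] using hyb
      · have hy' := image_mono (f := e) (ball_subset_closedBall (x := (0 : E)) (ε := ρ))
          (not_not.1 hyb)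
        rw [hfg y ⟨hy, hy'⟩]
        exact hgout y ⟨hy, hy'⟩
    · intro y hy
      refine ⟨y, ?_, if_pos hy⟩
      rintro rfl
      exact hy ⟨0, mem_ball_self h0, rfl⟩
  rw [← himg]
  exact (isConnected_compl_singleton_of_one_lt_rank hdim (e 0)).isPreconnected.image f hcont

end Retraction

/-! ### Collars of a boundary with Lipschitz normal -/

section NormalField

variable {E : Type*} [NormedAddCommGroup E] [InnerProductSpace ℝ E]

/-- `ν` is a unit normal field of the boundary of `U`, pointing outwards, which is Lipschitz with
constant `M` at distances smaller than `r`. -/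
structure IsLipschitzNormal (U : Set E) (ν : E → E) (r M : ℝ) : Prop where
  norm_eq : ∀ p ∈ frontier U, ‖ν p‖ = 1
  lipschitz : ∀ p ∈ frontier U, ∀ q ∈ frontier U, dist p q < r → ‖ν p - ν q‖ ≤ M * ‖p - q‖
  tangent : ∀ p ∈ frontier U, ∀ η > 0, ∀ᶠ q in 𝓝 p, q ∈ frontier U →
    |inner ℝ (ν p) (q - p)| ≤ η * ‖q - p‖
  nearest_inside : ∀ y ∈ U, ∀ p ∈ frontier U, dist y p = infDist y (frontier U) →
    y = p - infDist y (frontier U) • ν p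
  nearest_outside : ∀ y ∉ U, ∀ p ∈ frontier U, dist y p = infDist y (frontier U) →
    y = p + infDist y (frontier U) • ν p

namespace IsLipschitzNormal

variable {U : Set E} {ν : E → E} {r M δ : ℝ}

/-- The sign depends only on the side of `∂U` on which `y` lies, so it is common to all nearest
points. -/
theorem exists_sign (h : IsLipschitzNormal U ν r M) (y : E) : ∃ ε : ℝ, |ε| = 1 ∧
    ∀ p ∈ frontier U, dist y p = infDist y (frontier U) →
      y = p + (ε * infDist y (frontier U)) • ν p := by
  by_cases hy : y ∈ U
  · refine ⟨-1, by simp, fun p hp hd => ?_⟩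
    rw [neg_one_mul, neg_smul, ← sub_eq_add_neg]
    exact h.nearest_inside y hy p hp hd
  · refine ⟨1, by simp, fun p hp hd => ?_⟩
    rw [one_mul]
    exact h.nearest_outside y hy p hp hd

/-- Two nearest points are at distance at most `2δ < r` and satisfy `p - q = ±d (ν q - ν p)`, where
`d` is the distance to the boundary. The Lipschitz bound gives `‖p - q‖ ≤ d M ‖p - q‖` with `d M <
1`. -/
theorem nearest_unique (h : IsLipschitzNormal U ν r M) (hM : 0 < M) (hr : δ < r / 2)
    (hδ : δ * M < 1) {y p q : E} (hy : infDist y (frontier U) ≤ δ)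
    (hp : p ∈ frontier U) (hq : q ∈ frontier U)
    (hyp : dist y p = infDist y (frontier U)) (hyq : dist y q = infDist y (frontier U)) :
    p = q := by
  obtain ⟨ε, hε, hs⟩ := h.exists_sign y
  have h1 := hs p hp hyp
  have h2 := hs q hq hyq
  have hpq : dist p q < r := by
    have := dist_triangle_left p q y
    linarith
  have hl := h.lipschitz p hp q hq hpq
  set d := infDist y (frontier U) with hd
  have hd0 : 0 ≤ d := infDist_nonneg
  have h3 : p - q = (ε * d) • (ν q - ν p) := by
    rw [smul_sub, sub_eq_sub_iff_add_eq_add, add_comm _ q, ← h1, ← h2]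
  have h4 : ‖p - q‖ ≤ d * (M * ‖p - q‖) := by
    calc ‖p - q‖ = d * ‖ν p - ν q‖ := by
          rw [h3, norm_smul, norm_mul, Real.norm_eq_abs, hε, one_mul, Real.norm_of_nonneg hd0,
            norm_sub_rev]
      _ ≤ _ := by gcongr
  have h5 : d * M < 1 := lt_of_le_of_lt (by gcongr) hδ
  by_contra hne
  have h6 : 0 < ‖p - q‖ := norm_pos_iff.2 (sub_ne_zero.2 hne)
  nlinarith

/-- Moving from a boundary point in normal direction increases the distance at unit speed. -/
theorem infDist_add_smul (h : IsLipschitzNormal U ν r M) (hc : IsCompact (frontier U))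
    (hM : 0 < M) (hr : δ < r / 2) (hδ : δ * M < 1) {ε : ℝ} (hε : |ε| = 1)
    {p : E} (hp : p ∈ frontier U) {s : ℝ} (hs : s ∈ Icc 0 δ) :
    infDist (p + (ε * s) • ν p) (frontier U) = s := by
  have hne : (frontier U).Nonempty := ⟨p, hp⟩
  have hνp := h.norm_eq p hp
  have hcont : Continuous fun t : ℝ => infDist (p + (ε * t) • ν p) (frontier U) :=
    (continuous_infDist_pt _).comp (by fun_prop)
  have hdist : ∀ t : ℝ, 0 ≤ t → dist (p + (ε * t) • ν p) p = t := by
    intro t ht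
    rw [dist_eq_norm, add_sub_cancel_left, norm_smul, norm_mul, Real.norm_eq_abs, hε, hνp,
      Real.norm_of_nonneg ht, one_mul, mul_one]
  have hεε : ε * ε = 1 := by rw [← abs_mul_abs_self, hε, one_mul]
  -- Continuous induction on `[0, δ]`: the set of good parameters is closed, contains `0`, and can
  -- be prolonged to the right of each of its points.
  refine IsClosed.Icc_subset_of_forall_mem_nhdsWithin (a := 0) (b := δ)
    (s := {t | infDist (p + (ε * t) • ν p) (frontier U) = t}) ?_ ?_ ?_ hs
  · exact (isClosed_eq hcont continuous_id).inter isClosed_Icc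
  · simp [infDist_zero_of_mem hp]
  rintro σ ⟨hσ, hσ0, hσδ⟩
  rw [mem_ofPred_eq] at hσ
  -- The bound `1/8` will fix the side of the nearest point; the bound `(1 - δM)/2` gives `η + δM <
  -- 1` for the final contraction.
  set η : ℝ := min (1 / 8) ((1 - δ * M) / 2) with hη
  have hη0 : 0 < η := lt_min (by norm_num) (by linarith)
  have hη1 : η ≤ 1 / 8 := min_le_left _ _
  have hη2 : η ≤ (1 - δ * M) / 2 := min_le_right _ _
  have hr0 : 0 < r := by linarith
  -- a neighbourhood of `p` on which `ν` is almost constant and the boundary almost flat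
  have hev₀ : ∀ᶠ q in 𝓝 p, (q ∈ frontier U → |inner ℝ (ν p) (q - p)| ≤ η * ‖q - p‖) ∧
      q ∈ ball p r ∧ q ∈ ball p (1 / (2 * M)) := by
    filter_upwards [h.tangent p hp η hη0, ball_mem_nhds p hr0,
      ball_mem_nhds p (show 0 < 1 / (2 * M) by positivity)] with q h1 h2 h3
    exact ⟨h1, h2, h3⟩
  obtain ⟨N, hNsub, hNo, hpN⟩ := _root_.eventually_nhds_iff.1 hev₀
  -- At parameter `σ` the unique nearest point is `p`, so for nearby parameters every nearest point
  -- is near `p`.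
  have hev : ∀ᶠ y in 𝓝 (p + (ε * σ) • ν p), ∀ q ∈ frontier U,
      dist y q = infDist y (frontier U) → q ∈ N := by
    refine hc.eventually_nearest_mem hNo fun q hq hqd => ?_
    rwa [h.nearest_unique hM hr hδ (hσ.le.trans hσδ.le) hq hp hqd (by rw [hdist σ hσ0, hσ])]
  have hcs : Continuous fun t : ℝ => p + (ε * t) • ν p := by fun_prop
  filter_upwards [nhdsWithin_le_nhds (hcs.continuousAt.eventually hev),
    Ioo_mem_nhdsGT hσδ] with t ht htI
  have ht0 : 0 < t := hσ0.trans_lt htI.1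
  obtain ⟨q, hq, hqd⟩ := hc.exists_infDist_eq_dist hne (p + (ε * t) • ν p)
  have hqN := ht q hq hqd.symm
  obtain ⟨ht1, hqr, hqM⟩ := hNsub q hqN
  have htan := ht1 hq
  rw [mem_ball] at hqr hqM
  obtain ⟨ε', hε', hsg⟩ := h.exists_sign (p + (ε * t) • ν p)
  have heq := hsg q hq hqd.symm
  have hle : infDist (p + (ε * t) • ν p) (frontier U) ≤ t :=
    (infDist_le_dist_of_mem hp).trans (hdist t ht0.le).le
  have hu0 : 0 ≤ infDist (p + (ε * t) • ν p) (frontier U) := infDist_nonneg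
  set u := infDist (p + (ε * t) • ν p) (frontier U) with hu
  have hνq := h.norm_eq q hq
  have hlip : ‖ν q - ν p‖ ≤ M * ‖q - p‖ := h.lipschitz q hq p hp hqr
  have hsmall : ‖ν q - ν p‖ ≤ 1 / 2 := by
    refine hlip.trans ?_
    rw [dist_eq_norm, lt_div_iff₀ (by positivity)] at hqM
    linarith
  have hinner : inner ℝ (ν p) (ν q) = 1 - ‖ν q - ν p‖ ^ 2 / 2 := by
    have := norm_sub_sq_real (ν q) (ν p)
    rw [hνq, hνp, real_inner_comm] at this
    linarith
  have hpp : inner ℝ (ν p) (ν p) = 1 := by rw [real_inner_self_eq_norm_sq, hνp, one_pow]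
  have hqp : q - p = (ε * t) • ν p - (ε' * u) • ν q := by
    rw [eq_sub_iff_add_eq, sub_add_eq_add_sub, ← heq, add_sub_cancel_left]
  have hin : inner ℝ (ν p) (q - p) = ε * t - ε' * u * inner ℝ (ν p) (ν q) := by
    rw [hqp, inner_sub_right, inner_smul_right, inner_smul_right, hpp, mul_one]
  have hsq : ‖ν q - ν p‖ ^ 2 ≤ 1 / 4 := by
    have := pow_le_pow_left₀ (norm_nonneg _) hsmall 2
    linarith
  have hab := abs_le.1 htan
  have hqp2 : ‖q - p‖ ≤ t + u := by
    rw [hqp]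
    refine (norm_sub_le _ _).trans ?_
    rw [norm_smul, norm_smul, norm_mul, norm_mul, Real.norm_eq_abs, Real.norm_eq_abs ε', hε, hε',
      hνp, hνq, Real.norm_of_nonneg ht0.le, Real.norm_of_nonneg hu0]
    linarith
  -- Opposite signs would give `|⟨ν p, q - p⟩| ≥ t + 7u/8`, while near-flatness bounds it by `(t +
  -- u)/8`.
  have hsame : ε' = ε := by
    rcases (abs_eq zero_le_one).1 hε with h1 | h1 <;>
    rcases (abs_eq zero_le_one).1 hε' with h2 | h2
    · rw [h1, h2]
    · exfalso
      rw [h1, h2, hinner] at hin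
      nlinarith [hab.1, hab.2]
    · exfalso
      rw [h1, h2, hinner] at hin
      nlinarith [hab.1, hab.2]
    · rw [h1, h2]
  rw [hsame] at hqp hin
  have htu : t - u ≤ η * ‖q - p‖ := by
    have h1 : ε * inner ℝ (ν p) (q - p) = t - u * inner ℝ (ν p) (ν q) := by
      rw [hin]
      linear_combination (t - u * inner ℝ (ν p) (ν q)) * hεε
    have h2 : ε * inner ℝ (ν p) (q - p) ≤ η * ‖q - p‖ := by
      refine (le_abs_self _).trans ?_
      rw [abs_mul, hε, one_mul]
      exact htan
    rw [hinner] at h1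
    nlinarith [sq_nonneg ‖ν q - ν p‖]
  have hfin : ‖q - p‖ ≤ (t - u) + u * (M * ‖q - p‖) := by
    have h1 : q - p = (ε * (t - u)) • ν p - (ε * u) • (ν q - ν p) := by
      rw [hqp]; module
    calc ‖q - p‖ ≤ ‖(ε * (t - u)) • ν p‖ + ‖(ε * u) • (ν q - ν p)‖ := by
          conv_lhs => rw [h1]
          exact norm_sub_le _ _
      _ = (t - u) + u * ‖ν q - ν p‖ := by
          rw [norm_smul, norm_smul, norm_mul, norm_mul, Real.norm_eq_abs, hε, hνp,
            Real.norm_of_nonneg (sub_nonneg.2 hle), Real.norm_of_nonneg hu0]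
          ring
      _ ≤ _ := by gcongr
  have huM : u * M ≤ δ * M := by
    have : u ≤ δ := hle.trans htI.2.le
    gcongr
  -- Combining `htu`, `hfin` and `huM` yields `‖q - p‖ ≤ (η + δM) ‖q - p‖`.
  have hzero : ‖q - p‖ = 0 := by
    by_contra hne0
    have hpos : 0 < ‖q - p‖ := lt_of_le_of_ne (norm_nonneg _) (Ne.symm hne0)
    nlinarith
  rw [norm_eq_zero, sub_eq_zero] at hzero
  show u = t
  rw [hqd, hzero, hdist t ht0.le]

/-- Here `p` is a nearest boundary point. If the point were outside `U`, the outer normal formula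
would identify it with `p + δ ν p`. -/
theorem mem_of_sub_smul (h : IsLipschitzNormal U ν r M) (hc : IsCompact (frontier U))
    (hM : 0 < M) (hr : δ < r / 2) (hδ : δ * M < 1) (hδ0 : 0 < δ) {p : E} (hp : p ∈ frontier U) :
    p - δ • ν p ∈ U ∧ infDist (p - δ • ν p) (frontier U) = δ := by
  have hd : infDist (p - δ • ν p) (frontier U) = δ := by
    have := h.infDist_add_smul hc hM hr hδ (ε := -1) (by simp) hp (right_mem_Icc.2 hδ0.le)
    rwa [neg_one_mul, neg_smul, ← sub_eq_add_neg] at this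
  refine ⟨?_, hd⟩
  by_contra hU
  have h1 := h.nearest_outside _ hU p hp (by
    rw [hd, dist_eq_norm, sub_sub_cancel_left, norm_neg, norm_smul, h.norm_eq p hp,
      Real.norm_of_nonneg hδ0.le, mul_one])
  rw [hd] at h1
  have h2 : (2 * δ) • ν p = 0 := by
    have : (2 * δ) • ν p = (p + δ • ν p) - (p - δ • ν p) := by module
    rw [this, ← h1, sub_self]
  have h3 := congrArg norm h2
  rw [norm_smul, h.norm_eq p hp, norm_zero, Real.norm_of_nonneg (by linarith)] at h3
  linarith

theorem notMem_of_add_smul (h : IsLipschitzNormal U ν r M) (hc : IsCompact (frontier U))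
    (hM : 0 < M) (hr : δ < r / 2) (hδ : δ * M < 1) (hδ0 : 0 < δ) {p : E} (hp : p ∈ frontier U) :
    p + δ • ν p ∉ U ∧ infDist (p + δ • ν p) (frontier U) = δ := by
  have hd : infDist (p + δ • ν p) (frontier U) = δ := by
    have := h.infDist_add_smul hc hM hr hδ (ε := 1) (by simp) hp (right_mem_Icc.2 hδ0.le)
    rwa [one_mul] at this
  refine ⟨fun hU => ?_, hd⟩
  have h1 := h.nearest_inside _ hU p hp (by
    rw [hd, dist_eq_norm, add_sub_cancel_left, norm_smul, h.norm_eq p hp,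
      Real.norm_of_nonneg hδ0.le, mul_one])
  rw [hd] at h1
  have h2 : (2 * δ) • ν p = 0 := by
    have : (2 * δ) • ν p = (p + δ • ν p) - (p - δ • ν p) := by module
    rw [this, ← h1, sub_self]
  have h3 := congrArg norm h2
  rw [norm_smul, h.norm_eq p hp, norm_zero, Real.norm_of_nonneg (by linarith)] at h3
  linarith

theorem continuousOn (h : IsLipschitzNormal U ν r M) (hM : 0 < M) (hr : 0 < r) :
    ContinuousOn ν (frontier U) := by
  rw [Metric.continuousOn_iff]
  intro p hp η hη
  refine ⟨min r (η / M), lt_min hr (by positivity), fun q hq hqp => ?_⟩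
  rw [dist_eq_norm (ν q)]
  refine (h.lipschitz q hq p hp (hqp.trans_le (min_le_left _ _))).trans_lt ?_
  have := hqp.trans_le (min_le_right _ _)
  rwa [dist_eq_norm, lt_div_iff₀ hM, mul_comm] at this

/-- Pushing the points near the boundary of `U` along the normals onto the parallel surface at
distance `δ` retracts `D` onto `K`. -/
theorem isPreconnected_of_collar (h : IsLipschitzNormal U ν r M) (hc : IsCompact (frontier U))
    (hne : (frontier U).Nonempty) (hM : 0 < M) (hr0 : 0 < r) (hr : δ < r / 2) (hδ : δ * M < 1)
    {D K : Set E} (hD : IsPreconnected D) (hK : IsClosed K) (hKD : K ⊆ D) (τ : ℝ)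
    (hDK : ∀ y ∈ D, y ∉ K → infDist y (frontier U) ≤ δ)
    (hKτ : ∀ p ∈ frontier U, p + τ • ν p ∈ K)
    (hfix : ∀ y ∈ K, infDist y (frontier U) ≤ δ → ∀ p ∈ frontier U,
      dist y p = infDist y (frontier U) → p + τ • ν p = y) :
    IsPreconnected K := by
  classical
  choose π hπS hπd using fun y => hc.exists_infDist_eq_dist hne y
  let t : Set E := {y | infDist y (frontier U) ≤ δ}
  have ht : IsClosed t := isClosed_le (continuous_infDist_pt _) continuous_const
  have hπ : ContinuousOn π t := by
    intro y hy
    refine ContinuousAt.continuousWithinAt ?_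
    rw [ContinuousAt, _root_.tendsto_nhds]
    intro N hN hyN
    have := hc.eventually_nearest_mem (y₀ := y) hN fun q hq hqd => by
      rwa [h.nearest_unique hM hr hδ hy hq (hπS y) hqd (hπd y).symm]
    filter_upwards [this] with z hz
    exact hz _ (hπS z) (hπd z).symm
  let g : E → E := fun y => π y + τ • ν (π y)
  have hg : ContinuousOn g t :=
    hπ.add (((h.continuousOn hM hr0).comp hπ fun y _ => hπS y).const_smul τ)
  -- `hfix` says that `g` is the identity where `K` meets the collar `t`, so the two branches agree
  -- on the overlap.
  let f : E → E := fun y => if y ∈ K then y else g y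
  have hf : ContinuousOn f D := by
    refine ContinuousOn.of_closed_cover hK ht ?_ ?_ ?_
    · intro y hy
      by_cases hyK : y ∈ K
      · exact Or.inl hyK
      · exact Or.inr (hDK y hy hyK)
    · exact continuousOn_id.congr fun y hy => if_pos hy.2
    · refine (hg.mono inter_subset_right).congr fun y hy => ?_
      by_cases hyK : y ∈ K
      · simp only [f, if_pos hyK]
        exact (hfix y hyK hy.2 _ (hπS y) (hπd y).symm).symm
      · simp only [f, if_neg hyK]
  have himg : f '' D = K := by
    apply Subset.antisymm
    · rintro _ ⟨y, -, rfl⟩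
      by_cases hyK : y ∈ K
      · simpa only [f, if_pos hyK] using hyK
      · simpa only [f, if_neg hyK] using hKτ _ (hπS y)
    · exact fun y hy => ⟨y, hKD hy, if_pos hy⟩
  rw [← himg]
  exact hD.image f hf

/-- The points of `U` at distance at least `δ` from the boundary form a connected set. -/
theorem isPreconnected_inside (h : IsLipschitzNormal U ν r M) (hc : IsCompact (frontier U))
    (hne : (frontier U).Nonempty) (hU : IsOpen U) (hUc : IsPreconnected U)
    (hM : 0 < M) (hr : δ < r / 2) (hδ : δ * M < 1) (hδ0 : 0 < δ) :
    IsPreconnected {y | y ∈ U ∧ δ ≤ infDist y (frontier U)} := by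
  have hcl : {y | y ∈ U ∧ δ ≤ infDist y (frontier U)} =
      closure U ∩ {y | δ ≤ infDist y (frontier U)} := by
    ext y
    refine ⟨fun hy => ⟨subset_closure hy.1, hy.2⟩, fun hy => ⟨?_, hy.2⟩⟩
    by_contra hyU
    have h1 : y ∈ frontier U := ⟨hy.1, by rwa [hU.interior_eq]⟩
    have h2 : δ ≤ infDist y (frontier U) := hy.2
    rw [infDist_zero_of_mem h1] at h2
    linarith
  refine h.isPreconnected_of_collar hc hne hM (by linarith) hr hδ hUc ?_ (fun y hy => hy.1) (-δ)
    (fun y hy hyK => ?_) (fun p hp => ?_) (fun y hy hyδ p hp hpd => ?_)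
  · rw [hcl]
    exact isClosed_closure.inter (isClosed_le continuous_const (continuous_infDist_pt _))
  · by_contra! hlt
    exact hyK ⟨hy, hlt.le⟩
  · rw [neg_smul, ← sub_eq_add_neg]
    have := h.mem_of_sub_smul hc hM hr hδ hδ0 hp
    exact ⟨this.1, this.2.ge⟩
  · have h1 := h.nearest_inside y hy.1 p hp hpd
    rw [le_antisymm hyδ hy.2] at h1
    rw [neg_smul, ← sub_eq_add_neg, ← h1]

/-- The points outside of `U` at distance at least `δ` from the boundary form a connected set. -/
theorem isPreconnected_outside [FiniteDimensional ℝ E] (hdim : 1 < Module.rank ℝ E)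
    (h : IsLipschitzNormal U ν r M) (hc : IsCompact (frontier U))
    (hne : (frontier U).Nonempty) (hUb : Bornology.IsBounded U)
    (e : OpenPartialHomeomorph E E) (hes : e.source = ball 0 1) (het : e.target = U)
    (hM : 0 < M) (hr : δ < r / 2) (hδ : δ * M < 1) (hδ0 : 0 < δ) :
    IsPreconnected {y | y ∉ U ∧ δ ≤ infDist y (frontier U)} := by
  have hU : IsOpen U := het ▸ e.open_target
  have hcl : {y | y ∈ U ∧ δ ≤ infDist y (frontier U)} =
      closure U ∩ {y | δ ≤ infDist y (frontier U)} := by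
    ext y
    refine ⟨fun hy => ⟨subset_closure hy.1, hy.2⟩, fun hy => ⟨?_, hy.2⟩⟩
    by_contra hyU
    have h1 : y ∈ frontier U := ⟨hy.1, by rwa [hU.interior_eq]⟩
    have h2 : δ ≤ infDist y (frontier U) := hy.2
    rw [infDist_zero_of_mem h1] at h2
    linarith
  have hcomp : IsCompact {y | y ∈ U ∧ δ ≤ infDist y (frontier U)} := by
    rw [hcl]
    exact hUb.isCompact_closure.inter_right
      (isClosed_le continuous_const (continuous_infDist_pt _))
  -- The inner core is compact, so a smaller concentric ball already contains it. What remains of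
  -- `U` outside that ball lies in the collar and can be pushed out to distance `δ`.
  obtain ⟨ρ, hρ0, hρ1, hρ⟩ := e.exists_subset_image_ball hes hcomp fun y hy => het ▸ hy.1
  have himg : e '' ball 0 ρ ⊆ U := by
    rintro _ ⟨z, hz, rfl⟩
    rw [← het]
    exact e.map_source (hes ▸ ball_subset_ball hρ1.le hz)
  refine h.isPreconnected_of_collar hc hne hM (by linarith) hr hδ
    (e.isPreconnected_compl_image_ball hdim hes hρ0 hρ1) ?_ (fun y hy hyi => hy.1 (himg hyi)) δ
    (fun y hy hyK => ?_) (fun p hp => ?_) (fun y hy hyδ p hp hpd => ?_)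
  · exact hU.isClosed_compl.inter (isClosed_le continuous_const (continuous_infDist_pt _))
  · by_contra! hlt
    by_cases hyU : y ∈ U
    · exact hy (hρ ⟨hyU, hlt.le⟩)
    · exact hyK ⟨hyU, hlt.le⟩
  · have := h.notMem_of_add_smul hc hM hr hδ hδ0 hp
    exact ⟨this.1, this.2.ge⟩
  · have h1 := h.nearest_outside y hy.1 p hp hpd
    rw [le_antisymm hyδ hy.2] at h1
    exact h1.symm

/-- A bounded open set whose boundary stays near the boundary of `U`, but away from a ball centred
on the latter, lies near the boundary of `U`. -/
theorem infDist_lt_of_frontier [FiniteDimensional ℝ E] (hdim : 1 < Module.rank ℝ E)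
    (h : IsLipschitzNormal U ν r M) (hUb : Bornology.IsBounded U) (hUc : IsPreconnected U)
    (e : OpenPartialHomeomorph E E) (hes : e.source = ball 0 1) (het : e.target = U)
    (hM : 0 < M) (hr : δ < r / 2) (hδ : δ * M < 1) (hδ0 : 0 < δ)
    {x : E} (hx : x ∈ frontier U) {V : Set E} (hV : IsOpen V) (hVb : Bornology.IsBounded V)
    (hfr : ∀ y ∈ frontier V, infDist y (frontier U) < δ ∧ y ∉ ball x δ) :
    ∀ y ∈ V, infDist y (frontier U) < δ := by
  have hU : IsOpen U := het ▸ e.open_target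
  have hc : IsCompact (frontier U) :=
    isCompact_of_isClosed_isBounded isClosed_frontier (hUb.closure.subset frontier_subset_closure)
  have hne : (frontier U).Nonempty := ⟨x, hx⟩
  have : Nontrivial E := (rank_pos_iff_nontrivial (R := ℝ)).1 (zero_lt_one.trans hdim)
  have hout : ∀ y ∈ V, y ∉ U → infDist y (frontier U) < δ := by
    intro y hyV hyU
    by_contra! hlt
    have hsub := (h.isPreconnected_outside hdim hc hne hUb e hes het hM hr hδ
      hδ0).subset_of_disjoint_frontier hV ⟨y, ⟨hyU, hlt⟩, hyV⟩
      fun z hz hzV => not_lt.2 hz.2 (hfr z hzV).1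
    -- If `V` contained the outer core, three bounded sets would cover the space; the radius `δ + 1`
    -- leaves room for distance exactly `δ`.
    have hall : (univ : Set E) ⊆ (V ∪ U) ∪ thickening (δ + 1) (frontier U) := by
      intro z _
      by_cases hzU : z ∈ U
      · exact Or.inl (Or.inr hzU)
      rcases le_total δ (infDist z (frontier U)) with hz | hz
      · exact Or.inl (Or.inl (hsub ⟨hzU, hz⟩))
      · exact Or.inr (((mem_thickening_iff_infDist_lt hne).2 (by linarith)))
    exact NormedSpace.unbounded_univ ℝ E
      (((hVb.union hUb).union hc.isBounded.thickening).subset hall)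
  intro y hyV
  by_cases hyU : y ∈ U
  swap
  · exact hout y hyV hyU
  by_contra! hlt
  have hsub := (h.isPreconnected_inside hc hne hU hUc hM hr hδ hδ0).subset_of_disjoint_frontier hV
    ⟨y, ⟨hyU, hlt⟩, hyV⟩ fun z hz hzV => not_lt.2 hz.2 (hfr z hzV).1
  have hin := h.mem_of_sub_smul hc hM hr hδ hδ0 hx
  have hex := h.notMem_of_add_smul hc hM hr hδ hδ0 hx
  have hmem : x - δ • ν x ∈ V := hsub ⟨hin.1, hin.2.ge⟩
  have hclos : ∀ z, dist z x = δ → z ∈ closure (ball x δ) := by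
    intro z hz
    rw [closure_ball x hδ0.ne', mem_closedBall, hz]
  have h1 : (ball x δ ∩ V).Nonempty := by
    have : x - δ • ν x ∈ closure (ball x δ) := hclos _ (by
      rw [dist_eq_norm, sub_sub_cancel_left, norm_neg, norm_smul, h.norm_eq x hx,
        Real.norm_of_nonneg hδ0.le, mul_one])
    obtain ⟨z, hzV, hzb⟩ := mem_closure_iff.1 this V hV hmem
    exact ⟨z, hzb, hzV⟩
  have hball : ball x δ ⊆ V := (convex_ball x δ).isPreconnected.subset_of_disjoint_frontier hV h1
    fun z hz hzV => (hfr z hzV).2 hz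
  -- The point is in `closure V`, and its distance `δ` to `∂U` keeps it off `∂V`.
  have hexV : x + δ • ν x ∈ V := by
    by_contra hnot
    have hcl : x + δ • ν x ∈ closure V := closure_mono hball (hclos _ (by
      rw [dist_eq_norm, add_sub_cancel_left, norm_smul, h.norm_eq x hx,
        Real.norm_of_nonneg hδ0.le, mul_one]))
    have := (hfr _ ⟨hcl, by rwa [hV.interior_eq]⟩).1
    linarith [hex.2]
  have := hout _ hexV hex.1
  linarith [hex.2]

end IsLipschitzNormal

end NormalField

/-! ### Defining functions and the outward normal -/

/-- A linear form which is nonpositive on a half-space is a negative multiple of the form defining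
the half-space. -/
theorem normalize_eq_of_halfspace {E : Type*} [NormedAddCommGroup E] [InnerProductSpace ℝ E]
    {a g : E} (ha : a ≠ 0) (hg : g ≠ 0)
    (h : ∀ w : E, 0 < inner ℝ a w → inner ℝ g w ≤ (0 : ℝ)) :
    ‖g‖⁻¹ • g = -(‖a‖⁻¹ • a) := by
  have ha2 : 0 < inner ℝ a a := real_inner_self_pos.2 ha
  have hle : ∀ w : E, 0 ≤ inner ℝ a w → inner ℝ g w ≤ (0 : ℝ) := by
    intro w hw
    have hlim : Tendsto (fun t : ℝ => inner ℝ g (w + t • a)) (𝓝[>] 0) (𝓝 (inner ℝ g w)) := by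
      have : Continuous fun t : ℝ => inner ℝ g (w + t • a) := by fun_prop
      simpa using (this.tendsto 0).mono_left nhdsWithin_le_nhds
    refine le_of_tendsto hlim ?_
    filter_upwards [self_mem_nhdsWithin] with t ht
    refine h _ ?_
    rw [inner_add_right, inner_smul_right]
    have : 0 < t * inner ℝ a a := mul_pos ht ha2
    linarith
  -- The component `g - c • a` is orthogonal to `a`, hence an admissible test vector; testing on it
  -- gives `‖g - c • a‖² ≤ 0`.
  set c : ℝ := inner ℝ a g / inner ℝ a a with hc
  have hperp : inner ℝ a (g - c • a) = (0 : ℝ) := by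
    rw [inner_sub_right, inner_smul_right, hc, div_mul_cancel₀ _ ha2.ne', sub_self]
  have h1 := hle _ hperp.ge
  have h2 : inner ℝ (g - c • a) (g - c • a) = inner ℝ g (g - c • a) := by
    conv_lhs => rw [inner_sub_left, inner_smul_left, hperp, mul_zero, sub_zero]
  have hgc : g = c • a := by
    rw [← sub_eq_zero, ← inner_self_eq_zero (𝕜 := ℝ)]
    exact le_antisymm (h2.trans_le h1) real_inner_self_nonneg
  have hc0 : c < 0 := by
    refine lt_of_le_of_ne ?_ fun h0 => hg (by rw [hgc, h0, zero_smul])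
    have := h a ha2
    rw [hgc, inner_smul_left] at this
    exact nonpos_of_mul_nonpos_left this ha2
  rw [hgc, norm_smul, Real.norm_of_nonpos hc0.le, smul_smul, ← neg_smul]
  congr 1
  have := norm_ne_zero_iff.2 ha
  field_simp
  rw [div_self hc0.ne]

section Defining

variable {d : ℕ} {U : Set (Euc d)} {x : Euc d} {ρ : Euc d → ℝ}

namespace IsC2DefiningAt

theorem inner_gradient (w : Euc d) : inner ℝ (gradient ρ x) w = fderiv ℝ ρ x w := by
  rw [gradient, InnerProductSpace.toDual_symm_apply]

theorem differentiableAt (h : IsC2DefiningAt U x ρ) : DifferentiableAt ℝ ρ x :=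
  h.contDiffAt.differentiableAt (by norm_num)

theorem tendsto_slope (h : IsC2DefiningAt U x ρ) (w : Euc d) :
    Tendsto (fun t : ℝ => t⁻¹ • ρ (x + t • w)) (𝓝[>] 0) (𝓝 (inner ℝ (gradient ρ x) w)) := by
  have h1 : HasDerivAt (fun t : ℝ => ρ (x + t • w)) (fderiv ℝ ρ x w) 0 :=
    h.differentiableAt.hasFDerivAt.hasLineDerivAt w
  simpa [h.eq_zero, inner_gradient] using
    HasDerivAt.tendsto_slope_zero_right (x := (0 : ℝ)) h1

theorem eventually_mem_iff (h : IsC2DefiningAt U x ρ) (w : Euc d) :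
    ∀ᶠ t : ℝ in 𝓝[>] 0, (x + t • w ∈ U ↔ ρ (x + t • w) < 0) := by
  have : Tendsto (fun t : ℝ => x + t • w) (𝓝[>] 0) (𝓝 x) := by
    have hc : Continuous fun t : ℝ => x + t • w := by fun_prop
    simpa using (hc.tendsto 0).mono_left nhdsWithin_le_nhds
  exact this.eventually h.mem_iff

theorem eventually_notMem (h : IsC2DefiningAt U x ρ) {w : Euc d}
    (hw : 0 < inner ℝ (gradient ρ x) w) : ∀ᶠ t : ℝ in 𝓝[>] 0, x + t • w ∉ U := by
  filter_upwards [h.eventually_mem_iff w, (h.tendsto_slope w).eventually_const_lt hw,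
    self_mem_nhdsWithin] with t h1 h2 ht
  rw [h1, not_lt]
  rw [smul_eq_mul] at h2
  exact (pos_of_mul_pos_right h2 (inv_nonneg.2 (le_of_lt ht))).le

theorem eventually_mem (h : IsC2DefiningAt U x ρ) {w : Euc d}
    (hw : inner ℝ (gradient ρ x) w < 0) : ∀ᶠ t : ℝ in 𝓝[>] 0, x + t • w ∈ U := by
  filter_upwards [h.eventually_mem_iff w, (h.tendsto_slope w).eventually_lt_const hw,
    self_mem_nhdsWithin] with t h1 h2 ht
  rw [h1]
  rw [smul_eq_mul] at h2
  by_contra! h3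
  exact not_le.2 h2 (mul_nonneg (inv_nonneg.2 (le_of_lt ht)) h3)

/-- If the normals differed, some direction would enter `U` according to one function and leave it
according to the other. -/
theorem unitGradient_eq {ρ' : Euc d → ℝ} (h : IsC2DefiningAt U x ρ)
    (h' : IsC2DefiningAt U x ρ') : unitGradient ρ x = unitGradient ρ' x := by
  have := normalize_eq_of_halfspace (a := -gradient ρ' x) (g := gradient ρ x)
    (neg_ne_zero.2 h'.gradient_ne_zero) h.gradient_ne_zero fun w hw => by
      rw [inner_neg_left, neg_pos] at hw
      by_contra! hlt
      obtain ⟨t, h1, h2⟩ := ((h'.eventually_mem hw).and (h.eventually_notMem hlt)).exists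
      exact h2 h1
  rw [unitGradient, unitGradient, this, norm_neg, smul_neg, neg_neg]

theorem norm_unitGradient (h : IsC2DefiningAt U x ρ) : ‖unitGradient ρ x‖ = 1 := by
  have := norm_ne_zero_iff.2 h.gradient_ne_zero
  rw [unitGradient, norm_smul, norm_inv, norm_norm, inv_mul_cancel₀ this]

theorem contDiffAt_gradient (h : IsC2DefiningAt U x ρ) : ContDiffAt ℝ 1 (gradient ρ) x :=
  (InnerProductSpace.toDual ℝ (Euc d)).symm.toContinuousLinearEquiv.contDiff.contDiffAt.comp x
    (h.contDiffAt.fderiv_right (m := 1) (by norm_num))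

theorem contDiffAt_unitGradient (h : IsC2DefiningAt U x ρ) :
    ContDiffAt ℝ 1 (unitGradient ρ) x :=
  ((h.contDiffAt_gradient.norm ℝ h.gradient_ne_zero).inv
    (norm_ne_zero_iff.2 h.gradient_ne_zero)).smul h.contDiffAt_gradient

/-- A defining function at a boundary point is a defining function at the nearby boundary points. -/
theorem eventually (hU : IsOpen U) (h : IsC2DefiningAt U x ρ) :
    ∀ᶠ q in 𝓝 x, q ∈ frontier U → IsC2DefiningAt U q ρ := by
  filter_upwards [h.contDiffAt.eventually (by norm_num),
    h.contDiffAt_gradient.continuousAt.eventually_ne h.gradient_ne_zero,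
    h.mem_iff.eventually_nhds] with q h1 h2 h3 hq
  refine ⟨h1, le_antisymm ?_ ?_, h2, h3⟩
  · refine le_of_tendsto_of_frequently (h1.continuousAt.tendsto) ?_
    refine ((mem_closure_iff_frequently.1 hq.1).and_eventually h3).mono ?_
    rintro z ⟨hz, hzi⟩
    exact (hzi.1 hz).le
  · by_contra! hlt
    exact hq.2 (by rw [hU.interior_eq]; exact h3.self_of_nhds.2 hlt)

/-- `ρ` vanishes at both boundary points, so its first-order expansion at `x` reduces to the inner
product and a remainder `o(‖q - x‖)`. -/
theorem tangent (hU : IsOpen U) (h : IsC2DefiningAt U x ρ) {η : ℝ} (hη : 0 < η) :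
    ∀ᶠ q in 𝓝 x, q ∈ frontier U → |inner ℝ (unitGradient ρ x) (q - x)| ≤ η * ‖q - x‖ := by
  have hg : 0 < ‖gradient ρ x‖ := norm_pos_iff.2 h.gradient_ne_zero
  filter_upwards [h.eventually hU, h.differentiableAt.hasFDerivAt.isLittleO.def
    (mul_pos hη hg)] with q h1 h2 hq
  rw [(h1 hq).eq_zero, h.eq_zero, sub_zero, zero_sub, norm_neg, ← inner_gradient,
    Real.norm_eq_abs] at h2
  rw [unitGradient, inner_smul_left, abs_mul]
  simp only [map_inv₀, conj_trivial, abs_inv, abs_norm]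
  rw [inv_mul_le_iff₀ hg]
  linarith

end IsC2DefiningAt

open Classical in
/-- The outward unit normal of `∂U`. -/
noncomputable def outerNormal {d : ℕ} (U : Set (Euc d)) (x : Euc d) : Euc d :=
  if h : ∃ ρ, IsC2DefiningAt U x ρ then unitGradient h.choose x else 0

theorem IsC2DefiningAt.outerNormal_eq (h : IsC2DefiningAt U x ρ) :
    outerNormal U x = unitGradient ρ x := by
  have hex : ∃ ρ, IsC2DefiningAt U x ρ := ⟨ρ, h⟩
  rw [outerNormal, dif_pos hex]
  exact hex.choose_spec.unitGradient_eq h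

/-- The directions pointing from a sphere into its ball. -/
theorem eventually_add_smul_mem_ball {E : Type*} [NormedAddCommGroup E] [InnerProductSpace ℝ E]
    {y p w : E} (hw : 0 < inner ℝ (y - p) w) :
    ∀ᶠ t : ℝ in 𝓝[>] 0, p + t • w ∈ ball y (dist y p) := by
  have hlim : Tendsto (fun t : ℝ => t * ‖w‖ ^ 2) (𝓝[>] 0) (𝓝 0) := by
    have : Continuous fun t : ℝ => t * ‖w‖ ^ 2 := by fun_prop
    simpa using (this.tendsto 0).mono_left nhdsWithin_le_nhds
  filter_upwards [hlim.eventually_lt_const hw, self_mem_nhdsWithin] with t h1 ht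
  rw [mem_ball', dist_eq_norm, dist_eq_norm]
  refine lt_of_pow_lt_pow_left₀ 2 (norm_nonneg _) ?_
  have ht : 0 < t := ht
  rw [← sub_sub, norm_sub_sq_real, inner_smul_right, norm_smul, mul_pow, Real.norm_eq_abs, sq_abs]
  nlinarith

theorem notMem_of_mem_ball_infDist {X : Type*} [PseudoMetricSpace X] {S : Set X} {y z : X}
    (hz : z ∈ ball y (infDist y S)) : z ∉ S := fun hzS => by
  have := infDist_le_dist_of_mem (x := y) hzS
  rw [mem_ball'] at hz
  linarith

/-- The ball about `y` touching `∂U` at `x` lies in `U`, so no direction entering it can leave `U`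
to first order; the gradient must point opposite to `y - x`. -/
theorem IsC2DefiningAt.nearest_inside (hU : IsOpen U) (h : IsC2DefiningAt U x ρ) {y : Euc d}
    (hy : y ∈ U) (hx : x ∈ frontier U) (hd : dist y x = infDist y (frontier U)) :
    y = x - infDist y (frontier U) • unitGradient ρ x := by
  have hxU : x ∉ U := fun hxU => hx.2 (by rwa [hU.interior_eq])
  have hyx : y - x ≠ 0 := sub_ne_zero.2 fun he => hxU (he ▸ hy)
  have hsub : ball y (infDist y (frontier U)) ⊆ U :=
    (convex_ball _ _).isPreconnected.subset_of_disjoint_frontier hU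
      ⟨y, mem_ball_self (by rw [← hd, dist_pos]; exact sub_ne_zero.1 hyx), hy⟩
      fun z hz => notMem_of_mem_ball_infDist hz
  have := normalize_eq_of_halfspace hyx h.gradient_ne_zero fun w hw => by
    by_contra! hlt
    obtain ⟨t, h1, h2⟩ := ((eventually_add_smul_mem_ball hw).and (h.eventually_notMem hlt)).exists
    rw [hd] at h1
    exact h2 (hsub h1)
  rw [unitGradient, this, ← hd, dist_eq_norm, smul_neg, smul_smul,
    mul_inv_cancel₀ (norm_ne_zero_iff.2 hyx)]
  module

theorem IsC2DefiningAt.nearest_outside (hU : IsOpen U) (h : IsC2DefiningAt U x ρ) {y : Euc d}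
    (hy : y ∉ U) (hd : dist y x = infDist y (frontier U)) :
    y = x + infDist y (frontier U) • unitGradient ρ x := by
  rcases eq_or_ne (y - x) 0 with hyx | hyx
  · have : y = x := sub_eq_zero.1 hyx
    rw [← hd, this]
    simp
  have hsub : ∀ z ∈ ball y (infDist y (frontier U)), z ∉ U := by
    intro z hz hzU
    refine hy ((convex_ball _ _).isPreconnected.subset_of_disjoint_frontier hU ⟨z, hz, hzU⟩
      (fun z hz => notMem_of_mem_ball_infDist hz)
      (mem_ball_self (by rw [← hd, dist_pos]; exact sub_ne_zero.1 hyx)))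
  have := normalize_eq_of_halfspace hyx (neg_ne_zero.2 h.gradient_ne_zero) fun w hw => by
    rw [inner_neg_left, Left.neg_nonpos_iff]
    by_contra! hlt
    obtain ⟨t, h1, h2⟩ := ((eventually_add_smul_mem_ball hw).and (h.eventually_mem hlt)).exists
    rw [hd] at h1
    exact hsub _ h1 h2
  rw [norm_neg, smul_neg, neg_inj] at this
  rw [unitGradient, this, ← hd, dist_eq_norm, smul_smul,
    mul_inv_cancel₀ (norm_ne_zero_iff.2 hyx)]
  module

theorem IsC2Domain.isLipschitzNormal (hU : IsC2Domain U) {r M : ℝ}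
    (hL : ∀ p ∈ frontier U, ∀ q ∈ frontier U, dist p q < r →
      ‖outerNormal U p - outerNormal U q‖ ≤ M * ‖p - q‖) :
    IsLipschitzNormal U (outerNormal U) r M where
  norm_eq p hp := by
    obtain ⟨ρ, hρ⟩ := hU.exists_defining p hp
    rw [hρ.outerNormal_eq, hρ.norm_unitGradient]
  lipschitz := hL
  tangent p hp η hη := by
    obtain ⟨ρ, hρ⟩ := hU.exists_defining p hp
    rw [hρ.outerNormal_eq]
    exact hρ.tangent hU.isOpen hη
  nearest_inside y hy p hp hd := by
    obtain ⟨ρ, hρ⟩ := hU.exists_defining p hp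
    rw [hρ.outerNormal_eq]
    exact hρ.nearest_inside hU.isOpen hy hp hd
  nearest_outside y hy p hp hd := by
    obtain ⟨ρ, hρ⟩ := hU.exists_defining p hp
    rw [hρ.outerNormal_eq]
    exact hρ.nearest_outside hU.isOpen hy hd

/-- The normal of a bounded domain of class `C²` is Lipschitz at small distances. -/
theorem IsC2Domain.exists_lipschitz (hU : IsC2Domain U) :
    ∃ r M : ℝ, 0 < r ∧ 0 < M ∧ ∀ p ∈ frontier U, ∀ q ∈ frontier U, dist p q < r →
      ‖outerNormal U p - outerNormal U q‖ ≤ M * ‖p - q‖ := by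
  have hc : IsCompact (frontier U) := isCompact_of_isClosed_isBounded isClosed_frontier
    (hU.isBounded.closure.subset frontier_subset_closure)
  -- Only `p` is restricted to `T`, while `q` ranges over the whole boundary; this makes the
  -- property stable under unions.
  refine hc.induction_on (p := fun T => ∃ r M : ℝ, 0 < r ∧ 0 < M ∧ ∀ p ∈ T, ∀ q ∈ frontier U,
    dist p q < r → ‖outerNormal U p - outerNormal U q‖ ≤ M * ‖p - q‖) ?_ ?_ ?_ ?_
  · exact ⟨1, 1, one_pos, one_pos, fun p hp => hp.elim⟩
  · rintro s t hst ⟨r, M, hr, hM, h⟩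
    exact ⟨r, M, hr, hM, fun p hp => h p (hst hp)⟩
  · rintro s t ⟨r, M, hr, hM, h⟩ ⟨r', M', hr', hM', h'⟩
    refine ⟨min r r', max M M', lt_min hr hr', lt_max_of_lt_left hM, ?_⟩
    rintro p (hp | hp) q hq hpq
    · exact (h p hp q hq (hpq.trans_le (min_le_left _ _))).trans (by gcongr; exact le_max_left _ _)
    · exact (h' p hp q hq (hpq.trans_le (min_le_right _ _))).trans
        (by gcongr; exact le_max_right _ _)
  · intro x hx
    obtain ⟨ρ, hρ⟩ := hU.exists_defining x hx
    obtain ⟨K, t, ht, hK⟩ := hρ.contDiffAt_unitGradient.exists_lipschitzOnWith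
    obtain ⟨R, hR, hRs⟩ := Metric.mem_nhds_iff.1 (inter_mem ht (hρ.eventually hU.isOpen))
    -- Halving `R` keeps `q` in the good ball of radius `R`; `K + 1` makes the constant positive.
    refine ⟨ball x (R / 2) ∩ frontier U,
      inter_mem (mem_nhdsWithin_of_mem_nhds (ball_mem_nhds x (by positivity))) self_mem_nhdsWithin,
      R / 2, K + 1, by positivity, by positivity, ?_⟩
    rintro p ⟨hp, hpU⟩ q hq hpq
    have hpR : p ∈ ball x R := ball_subset_ball (by linarith) hp
    have hqR : q ∈ ball x R := by
      rw [mem_ball] at hp ⊢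
      have := dist_triangle_left q x p
      linarith
    rw [((hRs hpR).2 hpU).outerNormal_eq, ((hRs hqR).2 hq).outerNormal_eq]
    refine (hK.norm_sub_le (hRs hpR).1 (hRs hqR).1).trans ?_
    gcongr
    linarith

end Defining

/-! ### Principal curvatures and the derivative of the normal -/

section Curvature

variable {d : ℕ} {U : Set (Euc d)} {x : Euc d} {ρ : Euc d → ℝ}

namespace IsC2DefiningAt

theorem inner_fderiv_gradient (h : IsC2DefiningAt U x ρ) (u v : Euc d) :
    inner ℝ (fderiv ℝ (gradient ρ) x u) v = fderiv ℝ (fderiv ℝ ρ) x u v := by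
  have h1 : DifferentiableAt ℝ (fderiv ℝ ρ) x :=
    (h.contDiffAt.fderiv_right (m := 1) (by norm_num)).differentiableAt one_ne_zero
  have h2 : HasFDerivAt (gradient ρ) _ x :=
    (InnerProductSpace.toDual ℝ (Euc d)).symm.toContinuousLinearEquiv.hasFDerivAt.comp x
      h1.hasFDerivAt
  rw [h2.fderiv]
  exact InnerProductSpace.toDual_symm_apply

theorem inner_fderiv_gradient_comm (h : IsC2DefiningAt U x ρ) (u v : Euc d) :
    inner ℝ (fderiv ℝ (gradient ρ) x u) v = inner ℝ u (fderiv ℝ (gradient ρ) x v) := by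
  rw [real_inner_comm (fderiv ℝ (gradient ρ) x v), h.inner_fderiv_gradient,
    h.inner_fderiv_gradient]
  exact h.contDiffAt.isSymmSndFDerivAt (by simp) u v

/-- Differentiating the factor `‖∇ρ‖⁻¹` produces a multiple of `∇ρ`, which vanishes against a
tangent vector. On the tangent space the derivative of the normal is thus the Hessian of `ρ` up to
scaling, and so symmetric. -/
theorem inner_fderiv_unitGradient (h : IsC2DefiningAt U x ρ) (u : Euc d) {v : Euc d}
    (hv : inner ℝ (unitGradient ρ x) v = (0 : ℝ)) :
    inner ℝ (fderiv ℝ (unitGradient ρ) x u) v =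
      ‖gradient ρ x‖⁻¹ * inner ℝ (fderiv ℝ (gradient ρ) x u) v := by
  have hg : ‖gradient ρ x‖ ≠ 0 := norm_ne_zero_iff.2 h.gradient_ne_zero
  have hv' : inner ℝ (gradient ρ x) v = (0 : ℝ) := by
    rw [unitGradient, inner_smul_left] at hv
    exact (mul_eq_zero.1 hv).resolve_left (by simpa using h.gradient_ne_zero)
  have h1 : DifferentiableAt ℝ (fun y => ‖gradient ρ y‖⁻¹) x :=
    ((h.contDiffAt_gradient.norm ℝ h.gradient_ne_zero).inv hg).differentiableAt one_ne_zero
  have h2 : DifferentiableAt ℝ (gradient ρ) x :=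
    h.contDiffAt_gradient.differentiableAt one_ne_zero
  have h3 : HasFDerivAt (unitGradient ρ) _ x := h1.hasFDerivAt.smul h2.hasFDerivAt
  rw [h3.fderiv]
  simp [inner_add_left, inner_smul_left, hv']

/-- Obtained by differentiating `‖n‖² = 1`; it makes the tangent space invariant. -/
theorem inner_fderiv_unitGradient_self (h : IsC2DefiningAt U x ρ) (u : Euc d) :
    inner ℝ (unitGradient ρ x) (fderiv ℝ (unitGradient ρ) x u) = (0 : ℝ) := by
  have h1 := (h.contDiffAt_unitGradient.differentiableAt one_ne_zero).hasFDerivAt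
  have h2 := h1.inner ℝ h1
  have h3 : (fun y => inner ℝ (unitGradient ρ y) (unitGradient ρ y)) =ᶠ[𝓝 x]
      fun _ => (1 : ℝ) := by
    filter_upwards [h.contDiffAt_gradient.continuousAt.eventually_ne h.gradient_ne_zero] with y hy
    rw [real_inner_self_eq_norm_sq, unitGradient, norm_smul, norm_inv, norm_norm,
      inv_mul_cancel₀ (norm_ne_zero_iff.2 hy), one_pow]
  have h4 := (h2.congr_of_eventuallyEq h3.symm).unique (hasFDerivAt_const (1 : ℝ) x)
  have h5 := DFunLike.congr_fun h4 u
  simpa [real_inner_comm] using h5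

/-- A bound of the principal curvatures bounds the tangential derivatives of the normal. -/
theorem norm_fderiv_unitGradient_le (h : IsC2DefiningAt U x ρ) {κmax : ℝ}
    (hκ : ∀ κ : ℝ, IsPrincipalCurvature U x κ → |κ| ≤ κmax) (hκ0 : 0 ≤ κmax) {t : Euc d}
    (ht : inner ℝ (unitGradient ρ x) t = (0 : ℝ)) :
    ‖fderiv ℝ (unitGradient ρ) x t‖ ≤ κmax * ‖t‖ := by
  set A : Euc d →ₗ[ℝ] Euc d := (fderiv ℝ (unitGradient ρ) x : Euc d →ₗ[ℝ] Euc d) with hA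
  set T : Submodule ℝ (Euc d) := (ℝ ∙ unitGradient ρ x)ᗮ with hT
  have hmem : ∀ v, v ∈ T ↔ inner ℝ (unitGradient ρ x) v = (0 : ℝ) := fun v =>
    Submodule.mem_orthogonal_singleton_iff_inner_right
  have hAT : ∀ v ∈ T, A v ∈ T := fun v _ => (hmem _).2 (h.inner_fderiv_unitGradient_self v)
  have hsymm : (A.restrict hAT).IsSymmetric := by
    rintro ⟨u, hu⟩ ⟨v, hv⟩
    change inner ℝ (fderiv ℝ (unitGradient ρ) x u) v = inner ℝ u (fderiv ℝ (unitGradient ρ) x v)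
    rw [real_inner_comm (fderiv ℝ (unitGradient ρ) x v),
      h.inner_fderiv_unitGradient u ((hmem v).1 hv), h.inner_fderiv_unitGradient v ((hmem u).1 hu),
      h.inner_fderiv_gradient_comm, real_inner_comm]
  -- Spectral theorem on the tangent space: the eigenvalues are principal curvatures up to sign, and
  -- in an orthonormal eigenbasis they bound the operator.
  set b := hsymm.eigenvectorBasis rfl with hb
  have heig : ∀ i, |hsymm.eigenvalues rfl i| ≤ κmax := by
    intro i
    have h1 : A (b i) = hsymm.eigenvalues rfl i • (b i : Euc d) :=
      congrArg Subtype.val (hsymm.apply_eigenvectorBasis rfl i)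
    have h2 : (b i : Euc d) ≠ 0 := by
      have := b.orthonormal.ne_zero i
      simpa using this
    rw [← abs_neg]
    refine hκ _ ⟨ρ, h, b i, h2, ?_, ?_⟩
    · rw [real_inner_comm]
      exact (hmem _).1 (b i).2
    · rw [neg_smul, ← h1]
      rfl
  set t' : T := ⟨t, (hmem t).2 ht⟩ with ht'
  have hnorm : ‖A.restrict hAT t'‖ ^ 2 ≤ (κmax * ‖t'‖) ^ 2 := by
    rw [mul_pow, ← b.sum_sq_norm_inner_right, ← b.sum_sq_norm_inner_right, Finset.mul_sum]
    refine Finset.sum_le_sum fun i _ => ?_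
    have h1 : inner ℝ (b i) (A.restrict hAT t') =
        hsymm.eigenvalues rfl i * inner ℝ (b i) t' := by
      rw [← hsymm (b i) t', hsymm.apply_eigenvectorBasis rfl i]
      simp [inner_smul_left, hb]
    rw [h1, norm_mul, mul_pow]
    gcongr
    exact heig i
  exact le_of_sq_le_sq hnorm (by positivity)

end IsC2DefiningAt

end Curvature

/-! ### Lipschitz bound of the normal from a chart -/

section Chart

variable {n : ℕ}

theorem dist_flatEmb (s t : Euc n) : dist (flatEmb s) (flatEmb t) = dist s t := by
  simp [EuclideanSpace.dist_eq, flatEmb, Fin.sum_univ_castSucc]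

theorem flatEmb_mem {r : ℝ} {s : Euc n} (hs : s ∈ ball (0 : Euc n) r) :
    flatEmb s ∈ halfBallWithFace n r := by
  have h0 : flatEmb (0 : Euc n) = 0 := by
    ext i
    refine Fin.lastCases ?_ (fun j => ?_) i <;> simp [flatEmb]
  refine ⟨?_, by simp [flatEmb]⟩
  rw [mem_ball, ← h0, dist_flatEmb]
  exact hs

variable {U : Set (Euc (n + 1))} {r L Linv κmax : ℝ}

/-- A bi-Lipschitz chart and a bound of the principal curvatures give a Lipschitz bound of the
normal. -/
theorem IsC2Domain.lipschitz_of_chart (hU : IsC2Domain U) (hL : 0 < L) (hκ0 : 0 < κmax)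
    (hκ : ∀ x ∈ frontier U, ∀ κ : ℝ, IsPrincipalCurvature U x κ → |κ| ≤ κmax)
    {p q : Euc (n + 1)} {Φ : Euc (n + 1) → Euc (n + 1)} (hΦ : IsBoundaryChart U p r L Linv Φ)
    (hp : p ∈ frontier U) (hq : q ∈ frontier U) (hpq : dist p q < r) :
    ‖outerNormal U p - outerNormal U q‖ ≤ L * Linv * κmax * ‖p - q‖ := by
  have hr : 0 < r := dist_nonneg.trans_lt hpq
  set ψ : Euc n → Euc (n + 1) := fun s => Φ (flatEmb s) with hψ
  obtain ⟨s₀, hs₀, rfl⟩ := hΦ.face_bijOn.surjOn ⟨hp, mem_ball_self hr⟩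
  obtain ⟨s₁, hs₁, rfl⟩ := hΦ.face_bijOn.surjOn ⟨hq, mem_ball'.2 hpq⟩
  have hseg : ∀ τ ∈ Icc (0 : ℝ) 1, s₁ + τ • (s₀ - s₁) ∈ ball (0 : Euc n) r := fun τ hτ =>
    (convex_ball _ _).add_smul_sub_mem hs₁ hs₀ hτ
  have hψd : ∀ s ∈ ball (0 : Euc n) r, HasFDerivAt ψ (fderiv ℝ ψ s) s ∧ ‖fderiv ℝ ψ s‖ ≤ L := by
    intro s hs
    have h1 : HasFDerivAt ψ (fderiv ℝ ψ s) s :=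
      ((hΦ.face_contDiffOn.contDiffAt (isOpen_ball.mem_nhds hs)).differentiableAt
        one_ne_zero).hasFDerivAt
    refine ⟨h1, h1.le_of_lip' hL.le ?_⟩
    filter_upwards [isOpen_ball.mem_nhds hs] with z hz
    rw [← dist_eq_norm, ← dist_eq_norm, ← dist_flatEmb z s]
    exact hΦ.lipschitz _ (flatEmb_mem hz) _ (flatEmb_mem hs)
  -- The image of a segment is a path in `∂U` of speed at most `L ‖s₀ - s₁‖`. Along it the normal
  -- turns at rate at most `κmax` times the speed, and `Linv` converts the parameter distance back.
  set γ : ℝ → Euc (n + 1) := fun τ => ψ (s₁ + τ • (s₀ - s₁)) with hγ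
  have hγU : ∀ τ ∈ Icc (0 : ℝ) 1, γ τ ∈ frontier U := fun τ hτ =>
    (hΦ.face_bijOn.mapsTo (hseg τ hτ)).1
  have key : ∀ τ ∈ Icc (0 : ℝ) 1, ∃ v, HasDerivWithinAt (fun τ => outerNormal U (γ τ)) v
      (Icc 0 1) τ ∧ ‖v‖ ≤ κmax * (L * ‖s₀ - s₁‖) := by
    intro τ hτ
    obtain ⟨ρ, hρ⟩ := hU.exists_defining _ (hγU τ hτ)
    obtain ⟨h1, h2⟩ := hψd _ (hseg τ hτ)
    have h3 : HasDerivAt (fun τ : ℝ => s₁ + τ • (s₀ - s₁)) (s₀ - s₁) τ := by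
      simpa using ((hasDerivAt_id τ).smul_const (s₀ - s₁)).const_add s₁
    have hγd : HasDerivAt γ (fderiv ℝ ψ (s₁ + τ • (s₀ - s₁)) (s₀ - s₁)) τ :=
      HasFDerivAt.comp_hasDerivAt (l := ψ) τ h1 h3
    set w := fderiv ℝ ψ (s₁ + τ • (s₀ - s₁)) (s₀ - s₁) with hw
    have hev : ∀ᶠ τ' in 𝓝[Icc 0 1] τ, IsC2DefiningAt U (γ τ') ρ := by
      filter_upwards [nhdsWithin_le_nhds
        (hγd.continuousAt.eventually (hρ.eventually hU.isOpen)), self_mem_nhdsWithin] with τ' h h'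
      exact h (hγU τ' h')
    -- `ρ ∘ γ` vanishes near `τ` within `[0, 1]`, where `γ` is known to stay in `∂U`; hence the
    -- one-sided derivatives at the endpoints.
    have htan : inner ℝ (unitGradient ρ (γ τ)) w = (0 : ℝ) := by
      have h4 := (hρ.differentiableAt.hasFDerivAt.comp_hasDerivAt τ hγd).hasDerivWithinAt
        (s := Icc 0 1)
      have h5 : HasDerivWithinAt (ρ ∘ γ) 0 (Icc 0 1) τ :=
        (hasDerivWithinAt_const τ (Icc 0 1) (0 : ℝ)).congr_of_eventuallyEq
          (hev.mono fun τ' h => h.eq_zero) hρ.eq_zero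
      have h6 := (uniqueDiffOn_Icc zero_lt_one τ hτ).eq_deriv _ h4 h5
      rw [unitGradient, inner_smul_left, IsC2DefiningAt.inner_gradient, h6, mul_zero]
    refine ⟨fderiv ℝ (unitGradient ρ) (γ τ) w, ?_, ?_⟩
    · exact (((hρ.contDiffAt_unitGradient.differentiableAt
        one_ne_zero).hasFDerivAt.comp_hasDerivAt τ hγd).hasDerivWithinAt).congr_of_eventuallyEq
          (hev.mono fun τ' h => h.outerNormal_eq) hρ.outerNormal_eq
    · refine (hρ.norm_fderiv_unitGradient_le (hκ _ (hγU τ hτ)) hκ0.le htan).trans ?_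
      gcongr
      exact (ContinuousLinearMap.le_opNorm _ _).trans (by gcongr)
  have hmv := norm_image_sub_le_of_norm_deriv_le_segment_01
    (f := fun τ => outerNormal U (γ τ)) (C := κmax * (L * ‖s₀ - s₁‖))
    (fun τ hτ => (key τ hτ).choose_spec.1.differentiableWithinAt) fun τ hτ => by
      have hτ' := Ico_subset_Icc_self hτ
      obtain ⟨v, hv, hvn⟩ := key τ hτ'
      rwa [hv.derivWithin (uniqueDiffOn_Icc zero_lt_one τ hτ')]
  have hγ1 : γ 1 = ψ s₀ := by simp [hγ]
  have hγ0 : γ 0 = ψ s₁ := by simp [hγ]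
  simp only [hγ1, hγ0] at hmv
  refine hmv.trans ?_
  have hinv : ‖s₀ - s₁‖ ≤ Linv * ‖ψ s₀ - ψ s₁‖ := by
    rw [← dist_eq_norm, ← dist_eq_norm, ← dist_flatEmb s₀ s₁]
    exact hΦ.lipschitz_inv _ (flatEmb_mem hs₀) _ (flatEmb_mem hs₁)
  calc κmax * (L * ‖s₀ - s₁‖) ≤ κmax * (L * (Linv * ‖ψ s₀ - ψ s₁‖)) := by gcongr
    _ = _ := by ring

end Chart

/-! ### Regularity in the box and conclusion -/

theorem isBounded_openBox {d : ℕ} (a b : Euc d) : Bornology.IsBounded (openBox a b) := by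
  refine isBounded_iff_forall_norm_le.2 ⟨√(∑ i, (|a i| + |b i|) ^ 2), fun x hx => ?_⟩
  rw [EuclideanSpace.norm_eq]
  refine Real.sqrt_le_sqrt (Finset.sum_le_sum fun i _ => pow_le_pow_left₀ (norm_nonneg _) ?_ 2)
  rw [Real.norm_eq_abs, abs_le]
  have h1 := neg_abs_le (a i)
  have h2 := le_abs_self (b i)
  have h3 := abs_nonneg (a i)
  have h4 := abs_nonneg (b i)
  constructor <;> linarith [(hx i).1, (hx i).2]

theorem IsLipschitzNormal.deltaRegular {d : ℕ} (hd : 2 ≤ d) {a b : Euc d} {U : Set (Euc d)}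
    {ν : Euc d → Euc d} {r M δ : ℝ} (h : IsLipschitzNormal U ν r M)
    (hUb : Bornology.IsBounded U) (hUc : IsPreconnected U) (hball : DiffeoUnitBall U)
    (hM : 0 < M) (hδ0 : 0 < δ) (hδ : δ < min (r / 2) (1 / M)) :
    DeltaRegular (openBox a b) δ U := by
  intro x hx V hV hVbox hfr y hy
  obtain ⟨e, hes, het, -, -⟩ := hball
  obtain ⟨e', -, het', -, -⟩ := hV
  have hdim : 1 < Module.rank ℝ (Euc d) := by
    rw [← Module.finrank_eq_rank, finrank_euclideanSpace_fin]
    exact_mod_cast hd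
  refine ⟨hVbox (subset_closure hy), h.infDist_lt_of_frontier hdim hUb hUc e hes het hM
    (hδ.trans_le (min_le_left _ _)) ?_ hδ0 hx (het' ▸ e'.open_target)
    ((isBounded_openBox a b).subset (subset_closure.trans hVbox))
    (fun z hz => ⟨(hfr hz).1.2, (hfr hz).2⟩) y hy⟩
  exact (lt_div_iff₀ hM).1 (hδ.trans_le (min_le_right _ _))

theorem mainTheorem3 (n : ℕ) (hn : 1 ≤ n) (a b : Euc (n + 1)) (U : Set (Euc (n + 1)))
    (hU : IsC2Domain U) (hball : DiffeoUnitBall U) (hbox : closure U ⊆ openBox a b) :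
    (∃ δ₀ : ℝ, 0 < δ₀ ∧ ∀ δ : ℝ, 0 < δ → δ < δ₀ → DeltaRegular (openBox a b) δ U) ∧
    (∀ r L Linv κmax : ℝ, 0 < r → 0 < L → 0 < Linv → 0 < κmax →
      (∀ x ∈ frontier U, ∃ Φ : Euc (n + 1) → Euc (n + 1), IsBoundaryChart U x r L Linv Φ) →
      (∀ x ∈ frontier U, ∀ κ : ℝ, IsPrincipalCurvature U x κ → |κ| ≤ κmax) →
      ∀ δ : ℝ, 0 < δ → δ < min (r / 2) (1 / (L * Linv * κmax)) →
        DeltaRegular (openBox a b) δ U) := by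
  have hUc := hU.isConnected.isPreconnected
  constructor
  · obtain ⟨r, M, hr, hM, hL⟩ := hU.exists_lipschitz
    refine ⟨min (r / 2) (1 / M), by positivity, fun δ hδ0 hδ => ?_⟩
    exact (hU.isLipschitzNormal hL).deltaRegular (by omega) hU.isBounded hUc hball hM hδ0 hδ
  · intro r L Linv κmax hr hL hLinv hκ0 hchart hκ δ hδ0 hδ
    refine (hU.isLipschitzNormal fun p hp q hq hpq => ?_).deltaRegular (by omega) hU.isBounded hUc
      hball (by positivity) hδ0 hδ
    obtain ⟨Φ, hΦ⟩ := hchart p hp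
    exact hU.lipschitz_of_chart hL hκ0 hκ hΦ hp hq hpq
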